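/- For $\delta\in\mathbb R$ let $\mathbb H_\delta=\{s\in\mathbb C:\operatorname{Re}s>\delta\}$, let $\mathbb D$ be the open unit disc in $\mathbb C$, and let $\zeta$ be the Riemann zeta function. Let $H^\infty(\mathbb H_0)$ be the space of bounded holomorphic functions on $\mathbb H_0$, with norm $\|\varphi\|_\infty=\sup_{s\in\mathbb H_0}|\varphi(s)|$, and let $\mathcal D$ be the set of functions $\varphi$ representable by a convergent Dirichlet series in some right half-plane, i.e. for which there are coefficients $a_m\in\mathbb C$ and $\delta\in\mathbb R$ such that $\sum_{m\ge1}a_m m^{-s}$ converges to $\varphi(s)$ for all $s\in\mathbb H_\delta$. **Theorem 2.1.** Let $\lambda_1,\dots,\lambda_n$ be distinct points in $\mathbb H_{1/2}$ and let $w_1,\dots,w_n\in\mathbb D$. Suppose that there exists $\varphi\in H^\infty(\mathbb H_0)\cap\mathcal D$ such that $\|\varphi\|_\infty\le 1$ and $\varphi(\lambda_j)=w_j$ for $j=1,\dots,n$. Then: (i) the matrix $\big[(1-\overline{w}_iw_j)\,\zeta(\overline{\lambda}_i+\lambda_j)\big]_{i,j=1}^n$ is positive semi-definite; (ii) the matrix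 $\Big[\dfrac{1-\overline{w}_iw_j}{\overline{\lambda}_i+\lambda_j}\Big]_{i,j=1}^n$ is positive semi-definite and has rank equal to $n$. -/

import Mathlib

open scoped ComplexOrder ComplexConjugate

/-- The open right half-plane `{s : ℂ | δ < Re s}`. -/
def rightHalfPlane (δ : ℝ) : Set ℂ := {s : ℂ | δ < s.re}

/-- The bounded holomorphic functions on `Ω`; a function on `Ω` is represented by a function on `ℂ`
whose values off `Ω` play no role. -/
def HInfty (Ω : Set ℂ) : Set (ℂ → ℂ) :=
  {f | DifferentiableOn ℂ f Ω ∧ ∃ M : ℝ, ∀ s ∈ Ω, ‖f s‖ ≤ M}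

/-- The supremum norm of `f` on `Ω`, used for members of `HInfty Ω` only. -/
noncomputable def hInftyNorm (Ω : Set ℂ) (f : ℂ → ℂ) : ℝ := ⨆ s : Ω, ‖f s‖

/-- The functions that are represented, in some right half-plane, by a convergent (not necessarily
absolutely convergent) Dirichlet series `∑_{m ≥ 1} a m * m ^ (-s)`. Since the half-plane may always
be shrunk, it can be taken inside any given right half-plane on which `f` is of interest. -/
def dirichletRepresentable : Set (ℂ → ℂ) :=
  {f | ∃ (a : ℕ → ℂ) (δ : ℝ), ∀ s ∈ rightHalfPlane δ,
    Filter.Tendsto (fun N : ℕ => ∑ m ∈ Finset.Icc 1 N, a m * (m : ℂ) ^ (-s))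
      Filter.atTop (nhds (f s))}

/-! Part (i): multiplication by `φ` is a contraction on square-summable Dirichlet series, a Hilbert
space with reproducing kernel `ζ(conj s + t)`. Averaging `φ B` against `l ^ s` on the line `Re s =
ε` recovers the coefficients of `φ B` (`hasMean_mul_cpow_of_bounded`). Bessel's inequality and `ε →
0` then bound their `ℓ²` norm by that of the Dirichlet polynomial `B`
(`sum_norm_sq_convolution_le`). With `B = 1`, the coefficients of `φ` are in `ℓ²`, so its series
converges absolutely to `φ` on `Re s > 1/2`. Duality turns contractivity into positivity of the Pick
matrix (`tsum_norm_sq_sum_term_le`).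

Part (ii): the Schur algorithm removes one node at a time. The Pick matrix of a general Schur
function may be singular (a Blaschke product of low degree), so strictness is needed: `φ σ → a 1` as
`σ → ∞`, and `‖a 1‖ < 1`, since otherwise `∑ ‖a l‖² ≤ 1` makes `φ` a unimodular constant. Blaschke
factors tend to `1` at infinity, so each Schur step preserves this strictness
(`IsStrictSchur.exists_schur_step`), and induction gives definiteness, hence full rank. -/

open Filter Topology Complex MeasureTheory

/-! ### Cesàro means on the real line -/

/-- The function `g` on the real line has the (symmetric, Cesàro) mean value `v`. -/
def HasMean (g : ℝ → ℂ) (v : ℂ) : Prop :=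
  Tendsto (fun T : ℝ => (2 * T : ℂ)⁻¹ * ∫ t in (-T)..T, g t) atTop (𝓝 v)

lemma HasMean.const_mul {g : ℝ → ℂ} {v : ℂ} (h : HasMean g v) (k : ℂ) :
    HasMean (fun t => k * g t) (k * v) := by
  unfold HasMean at *
  refine (Tendsto.const_mul k h).congr fun T => ?_
  rw [intervalIntegral.integral_const_mul]
  ring

lemma HasMean.add {g h : ℝ → ℂ} {v w : ℂ} (hg : HasMean g v) (hh : HasMean h w)
    (cg : Continuous g) (ch : Continuous h) :
    HasMean (fun t => g t + h t) (v + w) := by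
  unfold HasMean at *
  refine (Tendsto.add hg hh).congr fun T => ?_
  rw [intervalIntegral.integral_add (cg.intervalIntegrable _ _) (ch.intervalIntegrable _ _)]
  ring

lemma HasMean.sum {ι : Type*} {s : Finset ι} {g : ι → ℝ → ℂ} {v : ι → ℂ}
    (hg : ∀ i ∈ s, HasMean (g i) (v i)) (cg : ∀ i ∈ s, Continuous (g i)) :
    HasMean (fun t => ∑ i ∈ s, g i t) (∑ i ∈ s, v i) := by
  unfold HasMean at *
  refine (tendsto_finsetSum s hg).congr fun T => ?_
  rw [intervalIntegral.integral_finsetSum fun i hi => (cg i hi).intervalIntegrable _ _,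
    Finset.mul_sum]

lemma HasMean.re_le {g h : ℝ → ℂ} {v w : ℂ} (hg : HasMean g v) (hh : HasMean h w)
    (cg : Continuous g) (ch : Continuous h) (hle : ∀ t, (g t).re ≤ (h t).re) :
    v.re ≤ w.re := by
  have key : ∀ (f : ℝ → ℂ) (_ : Continuous f) (T : ℝ),
      ((2 * T : ℂ)⁻¹ * ∫ t in (-T)..T, f t).re = (2 * T)⁻¹ * ∫ t in (-T)..T, (f t).re := by
    intro f cf T
    have : ∫ t in (-T)..T, (f t).re = (∫ t in (-T)..T, f t).re :=
      Complex.reCLM.intervalIntegral_comp_comm (cf.intervalIntegrable _ _)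
    rw [this, show ((2 * T : ℂ)⁻¹) = (((2 * T)⁻¹ : ℝ) : ℂ) by push_cast; rfl, re_ofReal_mul]
  refine le_of_tendsto_of_tendsto ((continuous_re.tendsto v).comp hg)
    ((continuous_re.tendsto w).comp hh) ?_
  filter_upwards [eventually_gt_atTop 0] with T hT
  simp only [Function.comp_apply, key g cg, key h ch]
  gcongr
  refine intervalIntegral.integral_mono_on (by linarith)
    ((continuous_re.comp cg).intervalIntegrable _ _)
    ((continuous_re.comp ch).intervalIntegrable _ _) fun t _ => hle t

lemma hasMean_const (v : ℂ) : HasMean (fun _ => v) v := by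
  refine tendsto_const_nhds.congr' ?_
  filter_upwards [eventually_gt_atTop 0] with T hT
  have : (T : ℂ) ≠ 0 := by exact_mod_cast hT.ne'
  simp only [intervalIntegral.integral_const, real_smul]
  push_cast
  field_simp
  ring

lemma norm_mean_le {g : ℝ → ℂ} {K T : ℝ} (hT : 0 < T) (hg : ∀ t, ‖g t‖ ≤ K) :
    ‖(2 * T : ℂ)⁻¹ * ∫ t in (-T)..T, g t‖ ≤ K := by
  have h := intervalIntegral.norm_integral_le_of_norm_le_const (a := -T) (b := T) fun t _ => hg t
  rw [sub_neg_eq_add, abs_of_pos (by linarith)] at h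
  rw [norm_mul, norm_inv]
  have : ‖(2 * T : ℂ)‖ = 2 * T := by
    rw [norm_mul, norm_real, Real.norm_of_nonneg hT.le]; simp
  rw [this, inv_mul_le_iff₀ (by linarith)]
  linarith

lemma hasMean_of_bounded_integral {g : ℝ → ℂ} {K : ℝ}
    (hg : ∀ T : ℝ, 0 < T → ‖∫ t in (-T)..T, g t‖ ≤ K) : HasMean g 0 := by
  have h0 : Tendsto (fun T : ℝ => (2 * T)⁻¹ * K) atTop (𝓝 (0 * K)) := by
    refine Tendsto.mul_const K (tendsto_inv_atTop_zero.comp ?_)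
    exact tendsto_id.const_mul_atTop two_pos
  rw [zero_mul] at h0
  refine squeeze_zero_norm' ?_ h0
  filter_upwards [eventually_gt_atTop 0] with T hT
  have : ‖(2 * T : ℂ)‖ = 2 * T := by
    rw [norm_mul, norm_real, Real.norm_of_nonneg hT.le]; simp
  rw [norm_mul, norm_inv, this]
  gcongr
  exact hg T hT

lemma hasMean_exp {θ : ℝ} (hθ : θ ≠ 0) : HasMean (fun t => cexp (θ * I * t)) 0 := by
  have hc : (θ * I : ℂ) ≠ 0 := mul_ne_zero (by exact_mod_cast hθ) I_ne_zero
  refine hasMean_of_bounded_integral (K := 2 / ‖(θ * I : ℂ)‖) fun T _ => ?_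
  rw [integral_exp_mul_complex hc, norm_div]
  gcongr
  refine (norm_sub_le _ _).trans ?_
  have : ∀ x : ℝ, ‖cexp (θ * I * x)‖ = 1 := fun x => by
    rw [show (θ * I * x : ℂ) = ((θ * x : ℝ) : ℂ) * I by push_cast; ring, norm_exp_ofReal_mul_I]
  rw [this, this]
  norm_num

/-! ### Coefficients of Dirichlet series as means on vertical lines -/

lemma natCast_cpow_vertical {l : ℕ} (hl : l ≠ 0) (σ t : ℝ) :
    (l : ℂ) ^ (σ + t * I : ℂ) = (l : ℂ) ^ (σ : ℂ) * cexp (Real.log l * I * t) := by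
  have : (l : ℂ) ≠ 0 := by exact_mod_cast hl
  rw [cpow_add _ _ this]
  congr 1
  rw [cpow_def_of_ne_zero this, natCast_log]
  congr 1
  ring

/-- Only a pure oscillation of frequency `log l - log m` depends on `t`, so averaging keeps exactly
the term `m = l`. -/
lemma term_mul_cpow_vertical (c : ℕ → ℂ) {l : ℕ} (hl : l ≠ 0) (σ t : ℝ) (m : ℕ) :
    LSeries.term c (σ + t * I) m * (l : ℂ) ^ (σ + t * I : ℂ) =
      LSeries.term c σ m * (l : ℂ) ^ (σ : ℂ) *
        cexp (((Real.log l - Real.log m : ℝ) : ℂ) * I * t) := by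
  rcases eq_or_ne m 0 with rfl | hm
  · simp
  rw [LSeries.term_of_ne_zero hm, LSeries.term_of_ne_zero hm, natCast_cpow_vertical hl,
    natCast_cpow_vertical hm]
  push_cast
  rw [sub_mul, sub_mul, exp_sub]
  have : (m : ℂ) ^ (σ : ℂ) ≠ 0 := by simp [cpow_eq_zero_iff, hm]
  have := exp_ne_zero (Real.log m * I * t)
  field_simp

lemma hasMean_term_mul_cpow (c : ℕ → ℂ) {l : ℕ} (hl : l ≠ 0) (σ : ℝ) (m : ℕ) :
    HasMean (fun t => LSeries.term c (σ + t * I) m * (l : ℂ) ^ (σ + t * I : ℂ))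
      (if m = l then c l else 0) := by
  simp only [term_mul_cpow_vertical c hl]
  split_ifs with h
  · subst h
    have : (m : ℂ) ^ (σ : ℂ) ≠ 0 := by simp [cpow_eq_zero_iff, hl]
    rw [LSeries.term_of_ne_zero hl, div_mul_cancel₀ _ this]
    simpa using hasMean_const (c m)
  · rcases eq_or_ne m 0 with rfl | hm
    · simpa using hasMean_const 0
    · have hθ : Real.log l - Real.log m ≠ 0 := by
        rw [sub_ne_zero]
        intro h'
        have := Real.log_injOn_pos (Set.mem_Ioi.2 (by positivity : (0 : ℝ) < l))
          (Set.mem_Ioi.2 (by positivity : (0 : ℝ) < m)) h'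
        exact h (by exact_mod_cast this.symm)
      simpa using (hasMean_exp hθ).const_mul (LSeries.term c σ m * (l : ℂ) ^ (σ : ℂ))

lemma continuous_term_vertical (c : ℕ → ℂ) (σ : ℝ) (m : ℕ) :
    Continuous fun t : ℝ => LSeries.term c (σ + t * I) m := by
  have := fun t => term_mul_cpow_vertical c one_ne_zero σ t m
  simp only [Nat.cast_one, one_cpow, mul_one] at this
  simp only [this]
  fun_prop

lemma norm_term_vertical (c : ℕ → ℂ) (σ t : ℝ) (m : ℕ) :
    ‖LSeries.term c (σ + t * I) m‖ = ‖LSeries.term c σ m‖ := by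
  simp [LSeries.norm_term_eq]

lemma continuous_LSeries_vertical {c : ℕ → ℂ} {σ : ℝ} (hc : LSeriesSummable c σ) :
    Continuous fun t : ℝ => LSeries c (σ + t * I) :=
  continuous_tsum (continuous_term_vertical c σ) hc.norm
    fun m t => (norm_term_vertical c σ t m).le

lemma continuous_natCast_cpow_vertical {l : ℕ} (hl : l ≠ 0) (σ : ℝ) :
    Continuous fun t : ℝ => (l : ℂ) ^ (σ + t * I : ℂ) := by
  simp only [natCast_cpow_vertical hl]
  fun_prop

lemma norm_natCast_cpow_vertical {l : ℕ} (hl : l ≠ 0) (σ t : ℝ) :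
    ‖(l : ℂ) ^ (σ + t * I : ℂ)‖ = (l : ℝ) ^ σ := by
  rw [norm_natCast_cpow_of_pos (Nat.pos_of_ne_zero hl)]
  simp

/-- The coefficients of an absolutely convergent Dirichlet series are mean values. -/
theorem hasMean_LSeries_mul_cpow {c : ℕ → ℂ} {σ : ℝ} (hc : LSeriesSummable c σ) {l : ℕ}
    (hl : l ≠ 0) :
    HasMean (fun t => LSeries c (σ + t * I) * (l : ℂ) ^ (σ + t * I : ℂ)) (c l) := by
  have hsum : Summable fun m => ‖LSeries.term c σ m‖ * (l : ℝ) ^ σ := hc.norm.mul_right _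
  have hbd : ∀ m (t : ℝ), ‖LSeries.term c (σ + t * I) m * (l : ℂ) ^ (σ + t * I : ℂ)‖ ≤
      ‖LSeries.term c σ m‖ * (l : ℝ) ^ σ := fun m t => by
    rw [norm_mul, norm_term_vertical, norm_natCast_cpow_vertical hl]
  have hcont : ∀ m, Continuous fun t : ℝ =>
      LSeries.term c (σ + t * I) m * (l : ℂ) ^ (σ + t * I : ℂ) := fun m =>
    (continuous_term_vertical c σ m).mul (continuous_natCast_cpow_vertical hl σ)
  have hint : ∀ T : ℝ, ∑' m, ((2 * T : ℂ)⁻¹ * ∫ t in (-T)..T,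
      LSeries.term c (σ + t * I) m * (l : ℂ) ^ (σ + t * I : ℂ)) =
      (2 * T : ℂ)⁻¹ * ∫ t in (-T)..T, LSeries c (σ + t * I) * (l : ℂ) ^ (σ + t * I : ℂ) := by
    intro T
    rw [tsum_mul_left]
    congr 1
    refine (intervalIntegral.hasSum_integral_of_dominated_convergence
      (fun m _ => ‖LSeries.term c σ m‖ * (l : ℝ) ^ σ)
      (fun m => (hcont m).aestronglyMeasurable) (fun m => ae_of_all _ fun t _ => hbd m t)
      (ae_of_all _ fun _ _ => hsum) (by simp) (ae_of_all _ fun t _ => ?_)).tsum_eq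
    have : LSeriesSummable c (σ + t * I) :=
      Summable.of_norm (by simpa only [norm_term_vertical] using hc.norm)
    exact this.hasSum.mul_right _
  have hlim : c l = ∑' m, if m = l then c l else 0 := by simp
  unfold HasMean
  simp only [← hint]
  rw [hlim]
  -- The bounds `hbd` do not depend on `t`, hence bound the means uniformly in `T`, and the limit
  -- passes through the sum.
  refine tendsto_tsum_of_dominated_convergence hsum (fun m => hasMean_term_mul_cpow c hl σ m) ?_
  filter_upwards [eventually_gt_atTop 0] with T hT m
  exact norm_mean_le hT (hbd m)

/-- By Cauchy's theorem on a rectangle, the two vertical integrals differ by the horizontal sides,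
which stay bounded as `T → ∞` and vanish after division by `2T`. -/
lemma hasMean_sub_of_shift {G : ℂ → ℂ} {ε A K : ℝ} (hεA : ε ≤ A)
    (hd : DifferentiableOn ℂ G {s | ε ≤ s.re}) (hb : ∀ s : ℂ, ε ≤ s.re → s.re ≤ A → ‖G s‖ ≤ K) :
    HasMean (fun t => G (ε + t * I) - G (A + t * I)) 0 := by
  have hline : ∀ σ : ℝ, ε ≤ σ → Continuous fun t : ℝ => G (σ + t * I) := fun σ hσ => by
    rw [← continuousOn_univ]
    exact hd.continuousOn.comp (by fun_prop) fun t _ => by simpa using hσ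
  refine hasMean_of_bounded_integral (K := 2 * (K * (A - ε))) fun T hT => ?_
  rw [intervalIntegral.integral_sub ((hline ε le_rfl).intervalIntegrable _ _)
    ((hline A hεA).intervalIntegrable _ _)]
  have hrect := Complex.integral_boundary_rect_eq_zero_of_differentiableOn G
    (ε + (-T : ℝ) * I) (A + T * I) (hd.mono fun s hs => by
      have := hs.1
      simp only [Set.mem_preimage] at this
      simp [Set.uIcc_of_le hεA] at this
      exact this.1)
  simp only [add_re, ofReal_re, mul_re, I_re, mul_zero, ofReal_im, I_im, mul_one, sub_self,
    add_zero, add_im, mul_im, zero_add, smul_eq_mul] at hrect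
  have hor : ∀ y : ℝ, ‖∫ x in ε..A, G (x + y * I)‖ ≤ K * (A - ε) := fun y => by
    have := intervalIntegral.norm_integral_le_of_norm_le_const (a := ε) (b := A) (C := K)
      (f := fun x : ℝ => G (x + y * I)) fun x hx => by
        rw [Set.uIoc_of_le hεA] at hx
        exact hb _ (by simpa using hx.1.le) (by simpa using hx.2)
    rwa [abs_of_nonneg (by linarith)] at this
  have heq : I * ((∫ t in (-T)..T, G (ε + t * I)) - ∫ t in (-T)..T, G (A + t * I)) =
      (∫ x in ε..A, G (x + (-T : ℝ) * I)) - ∫ x in ε..A, G (x + T * I) := by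
    linear_combination -hrect
  calc _ = ‖I * ((∫ t in (-T)..T, G (ε + t * I)) - ∫ t in (-T)..T, G (A + t * I))‖ := by simp
    _ ≤ _ := by
      rw [heq]
      refine (norm_sub_le _ _).trans ?_
      linarith [hor (-T), hor T]

/-- A bounded holomorphic function on the right half-plane which is a Dirichlet series far to the
right has the coefficients of that series as mean values on every vertical line. -/
theorem hasMean_mul_cpow_of_bounded {F : ℂ → ℂ} {c : ℕ → ℂ} {A K ε : ℝ} (hε : 0 < ε)
    (hεA : ε ≤ A) (hd : DifferentiableOn ℂ F (rightHalfPlane 0))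
    (hb : ∀ s ∈ rightHalfPlane 0, ‖F s‖ ≤ K) (hc : LSeriesSummable c A)
    (hF : ∀ s : ℂ, s.re = A → F s = LSeries c s) {l : ℕ} (hl : l ≠ 0) :
    HasMean (fun t => F (ε + t * I) * (l : ℂ) ^ (ε + t * I : ℂ)) (c l) := by
  have hl1 : (1 : ℝ) ≤ l := by exact_mod_cast Nat.one_le_iff_ne_zero.2 hl
  have hdG : DifferentiableOn ℂ (fun s => F s * (l : ℂ) ^ s) {s | ε ≤ s.re} := by
    refine (hd.mono fun s hs => lt_of_lt_of_le hε hs).mul fun s _ => ?_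
    exact (DifferentiableAt.const_cpow differentiableAt_id
      (Or.inl (by exact_mod_cast hl))).differentiableWithinAt
  have hshift := hasMean_sub_of_shift (G := fun s => F s * (l : ℂ) ^ s) (K := K * (l : ℝ) ^ A) hεA
    hdG fun s h1 h2 => by
      have hs : s ∈ rightHalfPlane 0 := lt_of_lt_of_le hε h1
      have hK : 0 ≤ K := (norm_nonneg _).trans (hb s hs)
      rw [norm_mul, norm_natCast_cpow_of_pos (Nat.pos_of_ne_zero hl)]
      exact mul_le_mul (hb s hs) (Real.rpow_le_rpow_of_exponent_le hl1 h2) (by positivity) hK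
  have hline : ∀ σ : ℝ, ε ≤ σ → Continuous fun t : ℝ => F (σ + t * I) * (l : ℂ) ^ (σ + t * I : ℂ) :=
    fun σ hσ => by
      rw [← continuousOn_univ]
      exact hdG.continuousOn.comp (f := fun t : ℝ => (σ + t * I : ℂ))
        (by fun_prop) fun t _ => by simpa using hσ
  have hA : HasMean (fun t => F (A + t * I) * (l : ℂ) ^ (A + t * I : ℂ)) (c l) := by
    have := hasMean_LSeries_mul_cpow hc hl
    refine this.congr fun T => ?_
    have h' : ∀ t : ℝ, F (A + t * I) = LSeries c (A + t * I) := fun t => hF _ (by simp)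
    simp only [h']
  simpa using hshift.add hA ((hline ε le_rfl).sub (hline A hεA)) (hline A hεA)

/-! ### Dirichlet polynomials and Bessel's inequality -/

lemma LSeries_eq_sum_of_support {p : ℕ → ℂ} {L : ℕ} (hp : ∀ m ∉ Finset.Icc 1 L, p m = 0)
    (s : ℂ) : LSeries p s = ∑ m ∈ Finset.Icc 1 L, LSeries.term p s m :=
  tsum_eq_sum fun m hm => by simp [LSeries.term_def, hp m hm]

lemma LSeriesSummable_of_support {p : ℕ → ℂ} {L : ℕ} (hp : ∀ m ∉ Finset.Icc 1 L, p m = 0)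
    (s : ℂ) : LSeriesSummable p s :=
  summable_of_ne_finset_zero (s := Finset.Icc 1 L) fun m hm => by
    simp [LSeries.term_def, hp m hm]

/-- Since `conj (m ^ (-s)) = m ^ (-2ε) * m ^ s` on the line `Re s = ε`, pairing with a conjugated
polynomial is a finite combination of coefficient means. -/
lemma conj_LSeries_vertical {p : ℕ → ℂ} {L : ℕ} (hp : ∀ m ∉ Finset.Icc 1 L, p m = 0)
    (ε t : ℝ) : conj (LSeries p (ε + t * I)) =
      ∑ m ∈ Finset.Icc 1 L, conj (p m) * ((m : ℝ) ^ (-2 * ε) : ℝ) * (m : ℂ) ^ (ε + t * I : ℂ) := by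
  rw [LSeries_eq_sum_of_support hp, map_sum]
  refine Finset.sum_congr rfl fun m hm => ?_
  have hm0 : m ≠ 0 := by have := (Finset.mem_Icc.1 hm).1; omega
  have hmC : (m : ℂ) ≠ 0 := by exact_mod_cast hm0
  rw [LSeries.term_of_ne_zero hm0, map_div₀, mul_assoc, div_eq_mul_inv]
  congr 1
  have hconj : conj ((m : ℂ) ^ (ε + t * I : ℂ)) = (m : ℂ) ^ conj (ε + t * I : ℂ) := by
    rw [cpow_conj _ _ (by rw [natCast_arg]; exact Real.pi_pos.ne), conj_natCast]
  rw [hconj, ofReal_cpow (by positivity), ← cpow_neg, ofReal_natCast, ← cpow_add _ _ hmC]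
  congr 1
  simp
  ring

lemma HasMean.mul_conj_LSeries {F : ℂ → ℂ} {c p : ℕ → ℂ} {L : ℕ} {ε : ℝ}
    (hF : ∀ l : ℕ, l ≠ 0 → HasMean (fun t => F (ε + t * I) * (l : ℂ) ^ (ε + t * I : ℂ)) (c l))
    (cF : Continuous fun t : ℝ => F (ε + t * I)) (hp : ∀ m ∉ Finset.Icc 1 L, p m = 0) :
    HasMean (fun t => F (ε + t * I) * conj (LSeries p (ε + t * I)))
      (∑ m ∈ Finset.Icc 1 L, conj (p m) * ((m : ℝ) ^ (-2 * ε) : ℝ) * c m) := by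
  have hne : ∀ m ∈ Finset.Icc 1 L, m ≠ 0 := fun m hm => by
    have := (Finset.mem_Icc.1 hm).1; omega
  have := HasMean.sum (s := Finset.Icc 1 L)
    (g := fun m t => conj (p m) * ((m : ℝ) ^ (-2 * ε) : ℝ) *
      (F (ε + t * I) * (m : ℂ) ^ (ε + t * I : ℂ)))
    (fun m hm => (hF m (hne m hm)).const_mul _)
    (fun m hm => continuous_const.mul (cF.mul (continuous_natCast_cpow_vertical (hne m hm) ε)))
  refine this.congr fun T => ?_
  congr 2
  ext t
  beta_reduce
  rw [conj_LSeries_vertical hp, Finset.mul_sum]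
  exact Finset.sum_congr rfl fun m _ => by ring

lemma hasMean_LSeries_mul_conj_self {p : ℕ → ℂ} {L : ℕ} (hp : ∀ m ∉ Finset.Icc 1 L, p m = 0)
    (ε : ℝ) : HasMean (fun t => LSeries p (ε + t * I) * conj (LSeries p (ε + t * I)))
      (∑ m ∈ Finset.Icc 1 L, ‖p m‖ ^ 2 * (m : ℝ) ^ (-2 * ε) : ℝ) := by
  have := HasMean.mul_conj_LSeries (F := LSeries p) (c := p)
    (fun l hl => hasMean_LSeries_mul_cpow (LSeriesSummable_of_support hp ε) hl)
    (continuous_LSeries_vertical (LSeriesSummable_of_support hp ε)) hp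
  convert this using 1
  push_cast
  refine Finset.sum_congr rfl fun m _ => ?_
  rw [← conj_mul']
  ring

/-- Bessel's inequality for the mean values of a bounded function dominated, on a vertical line,
by a Dirichlet polynomial. -/
theorem sum_norm_sq_mul_rpow_le {F : ℂ → ℂ} {c b : ℕ → ℂ} {A K ε : ℝ} {N : ℕ} (hε : 0 < ε)
    (hεA : ε ≤ A) (hd : DifferentiableOn ℂ F (rightHalfPlane 0))
    (hb : ∀ s ∈ rightHalfPlane 0, ‖F s‖ ≤ K) (hc : LSeriesSummable c A)
    (hF : ∀ s : ℂ, s.re = A → F s = LSeries c s) (hbN : ∀ m ∉ Finset.Icc 1 N, b m = 0)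
    (hle : ∀ s ∈ rightHalfPlane 0, ‖F s‖ ≤ ‖LSeries b s‖) (L : ℕ) :
    ∑ l ∈ Finset.Icc 1 L, ‖c l‖ ^ 2 * (l : ℝ) ^ (-2 * ε) ≤
      ∑ m ∈ Finset.Icc 1 N, ‖b m‖ ^ 2 * (m : ℝ) ^ (-2 * ε) := by
  set p : ℕ → ℂ := fun m => if m ∈ Finset.Icc 1 L then c m else 0 with hpdef
  have hp : ∀ m ∉ Finset.Icc 1 L, p m = 0 := fun m hm => if_neg hm
  have hpc : ∀ m ∈ Finset.Icc 1 L, p m = c m := fun m hm => if_pos hm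
  have cF : Continuous fun t : ℝ => F (ε + t * I) := by
    rw [← continuousOn_univ]
    exact hd.continuousOn.comp (by fun_prop) fun t _ => by simpa [rightHalfPlane] using hε
  have cP := continuous_LSeries_vertical (LSeriesSummable_of_support hp ε)
  have cB := continuous_LSeries_vertical (LSeriesSummable_of_support hbN ε)
  have h1 := HasMean.mul_conj_LSeries
    (fun l hl => hasMean_mul_cpow_of_bounded hε hεA hd hb hc hF hl) cF hp
  have h2 := hasMean_LSeries_mul_conj_self hp ε
  have h3 := hasMean_LSeries_mul_conj_self hbN ε
  have h4 : ∑ m ∈ Finset.Icc 1 L, conj (p m) * ((m : ℝ) ^ (-2 * ε) : ℝ) * c m =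
      (∑ m ∈ Finset.Icc 1 L, ‖p m‖ ^ 2 * (m : ℝ) ^ (-2 * ε) : ℝ) := by
    push_cast
    refine Finset.sum_congr rfl fun m hm => ?_
    rw [← conj_mul', hpc m hm]
    ring
  rw [h4] at h1
  have cFP := cF.mul (continuous_conj.comp cP)
  have cPP := cP.mul (continuous_conj.comp cP)
  have cBB := cB.mul (continuous_conj.comp cB)
  -- Averages `2 Re (F conj P) - |P|² ≤ |F|² ≤ |B|²`, with `P` the polynomial of `p`. Comparison
  -- with `B` avoids asking whether `|F|²` has a mean.
  have h5 := ((h1.const_mul 2).add (h2.const_mul (-1)) (continuous_const.mul cFP)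
    (continuous_const.mul cPP)).re_le h3 ((continuous_const.mul cFP).add
    (continuous_const.mul cPP)) cBB fun t => by
      have hs : (ε + t * I : ℂ) ∈ rightHalfPlane 0 := by simpa [rightHalfPlane] using hε
      have hnorm : ∀ z : ℂ, (z * conj z).re = ‖z‖ ^ 2 := fun z => by
        rw [mul_conj', ← ofReal_pow, ofReal_re]
      have hsq := normSq_nonneg (F (ε + t * I) - LSeries p (ε + t * I))
      rw [normSq_sub, normSq_eq_norm_sq, normSq_eq_norm_sq] at hsq
      have hFB := pow_le_pow_left₀ (norm_nonneg _) (hle _ hs) 2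
      simp only [add_re, neg_mul, one_mul, neg_re, hnorm]
      rw [show (2 : ℂ) = ((2 : ℝ) : ℂ) by norm_num, re_ofReal_mul]
      linarith
  have h6 : ∑ l ∈ Finset.Icc 1 L, ‖c l‖ ^ 2 * (l : ℝ) ^ (-2 * ε) =
      ∑ l ∈ Finset.Icc 1 L, ‖p l‖ ^ 2 * (l : ℝ) ^ (-2 * ε) :=
    Finset.sum_congr rfl fun m hm => by rw [hpc m hm]
  rw [h6]
  rw [show (2 : ℂ) = ((2 : ℝ) : ℂ) by norm_num, add_re, re_ofReal_mul, neg_one_mul, neg_re] at h5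
  simp only [ofReal_re] at h5
  linarith

theorem sum_norm_sq_le_of_norm_le_LSeries {F : ℂ → ℂ} {c b : ℕ → ℂ} {A K : ℝ} {N : ℕ} (hA : 0 < A)
    (hd : DifferentiableOn ℂ F (rightHalfPlane 0))
    (hb : ∀ s ∈ rightHalfPlane 0, ‖F s‖ ≤ K) (hc : LSeriesSummable c A)
    (hF : ∀ s : ℂ, s.re = A → F s = LSeries c s) (hbN : ∀ m ∉ Finset.Icc 1 N, b m = 0)
    (hle : ∀ s ∈ rightHalfPlane 0, ‖F s‖ ≤ ‖LSeries b s‖) (L : ℕ) :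
    ∑ l ∈ Finset.Icc 1 L, ‖c l‖ ^ 2 ≤ ∑ m ∈ Finset.Icc 1 N, ‖b m‖ ^ 2 := by
  have hlim : ∀ (q : ℕ → ℂ) (M : ℕ),
      Tendsto (fun ε : ℝ => ∑ m ∈ Finset.Icc 1 M, ‖q m‖ ^ 2 * (m : ℝ) ^ (-2 * ε)) (𝓝[>] 0)
        (𝓝 (∑ m ∈ Finset.Icc 1 M, ‖q m‖ ^ 2)) := by
    intro q M
    refine tendsto_finsetSum _ fun m hm => ?_
    have hm0 : (m : ℝ) ≠ 0 := by
      have := (Finset.mem_Icc.1 hm).1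
      positivity
    have hcont : Continuous fun ε : ℝ => ‖q m‖ ^ 2 * (m : ℝ) ^ (-2 * ε) :=
      continuous_const.mul (Real.continuous_const_rpow hm0 |>.comp (by fun_prop))
    simpa using (hcont.tendsto 0).mono_left nhdsWithin_le_nhds
  refine le_of_tendsto_of_tendsto (hlim c L) (hlim b N) ?_
  filter_upwards [Ioc_mem_nhdsGT hA] with ε hε
  exact sum_norm_sq_mul_rpow_le hε.1 hε.2 hd hb hc hF hbN hle L

/-! ### From conditional to absolute convergence -/

lemma sum_Icc_one_eq_sum_range {M : Type*} [AddCommMonoid M] {q : ℕ → M} (hq : q 0 = 0) (N : ℕ) :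
    ∑ m ∈ Finset.Icc 1 N, q m = ∑ m ∈ Finset.range (N + 1), q m := by
  rw [Finset.sum_range_succ', hq, add_zero, Finset.range_eq_Ico, Finset.sum_Ico_add' q 0 N 1]
  rfl

lemma HasSum.tendsto_sum_Icc {q : ℕ → ℂ} {v : ℂ} (h : HasSum q v) (hq : q 0 = 0) :
    Tendsto (fun N => ∑ m ∈ Finset.Icc 1 N, q m) atTop (𝓝 v) := by
  simp only [sum_Icc_one_eq_sum_range hq]
  exact (tendsto_add_atTop_iff_nat 1).2 h.tendsto_sum_nat

/-- A function represented by a convergent Dirichlet series is represented by an absolutely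
convergent one further to the right. -/
theorem exists_LSeries_of_dirichletRepresentable {f : ℂ → ℂ} (hf : f ∈ dirichletRepresentable) :
    ∃ (a : ℕ → ℂ) (A : ℝ), 0 < A ∧
      ∀ s : ℂ, A ≤ s.re → LSeriesSummable a s ∧ f s = LSeries a s := by
  obtain ⟨a, δ, h⟩ := hf
  set x : ℝ := max δ 0 + 1 with hx
  have hxδ : δ < x := by have := le_max_left δ 0; linarith
  have hx0 : 0 < x := by have := le_max_right δ 0; linarith
  have hterm : Tendsto (fun N : ℕ => a (N + 1) * ((N + 1 : ℕ) : ℂ) ^ (-(x : ℂ))) atTop (𝓝 0) := by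
    have h0 := h x (by simpa [rightHalfPlane] using hxδ)
    have h1 := (tendsto_add_atTop_iff_nat 1).2 h0
    have h2 := h1.sub h0
    rw [sub_self] at h2
    refine h2.congr fun N => ?_
    rw [Finset.sum_Icc_succ_top (by omega)]
    ring
  obtain ⟨C, hC⟩ := (Metric.isBounded_range_of_tendsto _ hterm).exists_norm_le
  have hbound : ∀ n : ℕ, n ≠ 0 → ‖a n‖ ≤ C * (n : ℝ) ^ (x + 1 - 1) := by
    intro n hn
    obtain ⟨N, rfl⟩ := Nat.exists_eq_succ_of_ne_zero hn
    have := hC _ ⟨N, rfl⟩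
    rw [norm_mul, norm_natCast_cpow_of_pos (Nat.succ_pos N), neg_re, ofReal_re,
      Real.rpow_neg (by positivity), ← div_eq_mul_inv, div_le_iff₀ (by positivity)] at this
    simpa using this
  -- Coefficients of size `O(n ^ x)` give absolute convergence for `Re s > x + 1`; `x + 2` leaves
  -- room for a closed half-plane.
  refine ⟨a, x + 2, by linarith, fun s hs => ?_⟩
  have hsum : LSeriesSummable a s :=
    LSeriesSummable_of_le_const_mul_rpow (x := x + 1) (by linarith) ⟨C, hbound⟩
  have hsδ : s ∈ rightHalfPlane δ := by
    simp only [rightHalfPlane, Set.mem_ofPred_eq]; linarith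
  refine ⟨hsum, tendsto_nhds_unique (h s hsδ) ?_⟩
  refine (HasSum.tendsto_sum_Icc hsum.hasSum (by simp)).congr fun N => ?_
  refine Finset.sum_congr rfl fun m hm => ?_
  have hm0 : m ≠ 0 := by have := (Finset.mem_Icc.1 hm).1; omega
  rw [LSeries.term_of_ne_zero hm0, cpow_neg, div_eq_mul_inv]

lemma norm_LSeries_le_of_support {b : ℕ → ℂ} {N : ℕ} (hb : ∀ m ∉ Finset.Icc 1 N, b m = 0)
    {s : ℂ} (hs : s ∈ rightHalfPlane 0) : ‖LSeries b s‖ ≤ ∑ m ∈ Finset.Icc 1 N, ‖b m‖ := by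
  rw [LSeries_eq_sum_of_support hb]
  refine norm_sum_le_of_le _ fun m hm => ?_
  have hm1 := (Finset.mem_Icc.1 hm).1
  rw [LSeries.norm_term_eq, if_neg (by omega)]
  refine div_le_self (norm_nonneg _) (Real.one_le_rpow (by exact_mod_cast hm1) ?_)
  exact le_of_lt hs

lemma differentiable_LSeries_of_support {b : ℕ → ℂ} {N : ℕ}
    (hb : ∀ m ∉ Finset.Icc 1 N, b m = 0) : Differentiable ℂ (LSeries b) := by
  rw [show LSeries b = _ from funext (LSeries_eq_sum_of_support hb)]
  exact Differentiable.fun_sum fun m _ s => (LSeries.hasDerivAt_term b m s).differentiableAt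

/-! ### Bounded Dirichlet series as contractive multipliers -/

section Multiplier

variable {φ : ℂ → ℂ} {a : ℕ → ℂ} {A : ℝ}

/-- A Dirichlet series bounded by one on the right half-plane is a contractive multiplier of the
Hardy space of square-summable Dirichlet series. -/
theorem sum_norm_sq_convolution_le (hA : 0 < A) (hd : DifferentiableOn ℂ φ (rightHalfPlane 0))
    (h1 : ∀ s ∈ rightHalfPlane 0, ‖φ s‖ ≤ 1)
    (hφ : ∀ s : ℂ, A ≤ s.re → LSeriesSummable a s ∧ φ s = LSeries a s)
    {b : ℕ → ℂ} {N : ℕ} (hb : ∀ m ∉ Finset.Icc 1 N, b m = 0) (L : ℕ) :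
    ∑ l ∈ Finset.Icc 1 L, ‖LSeries.convolution a b l‖ ^ 2 ≤ ∑ m ∈ Finset.Icc 1 N, ‖b m‖ ^ 2 := by
  have hle : ∀ s ∈ rightHalfPlane 0, ‖φ s * LSeries b s‖ ≤ ‖LSeries b s‖ := fun s hs => by
    rw [norm_mul]
    exact mul_le_of_le_one_left (norm_nonneg _) (h1 s hs)
  refine sum_norm_sq_le_of_norm_le_LSeries (F := fun s => φ s * LSeries b s) hA
    (hd.mul (differentiable_LSeries_of_support hb).differentiableOn)
    (fun s hs => (hle s hs).trans (norm_LSeries_le_of_support hb hs))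
    ((hφ A (by simp)).1.convolution (LSeriesSummable_of_support hb _)) (fun s hs => ?_) hb hle L
  rw [LSeries_convolution' (hφ s hs.ge).1 (LSeriesSummable_of_support hb _), (hφ s hs.ge).2]

theorem sum_norm_sq_coeff_le_one (hA : 0 < A) (hd : DifferentiableOn ℂ φ (rightHalfPlane 0))
    (h1 : ∀ s ∈ rightHalfPlane 0, ‖φ s‖ ≤ 1)
    (hφ : ∀ s : ℂ, A ≤ s.re → LSeriesSummable a s ∧ φ s = LSeries a s) (L : ℕ) :
    ∑ l ∈ Finset.Icc 1 L, ‖a l‖ ^ 2 ≤ 1 := by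
  -- The polynomial is the constant `1`, whose only coefficient sits at `m = 1`.
  have hb : ∀ m ∉ Finset.Icc 1 1, (fun m : ℕ => if m = 1 then (1 : ℂ) else 0) m = 0 := by
    simp
  have hL : ∀ s, LSeries (fun m : ℕ => if m = 1 then (1 : ℂ) else 0) s = 1 := fun s => by
    rw [LSeries_eq_sum_of_support hb]
    simp
  have := sum_norm_sq_le_of_norm_le_LSeries hA hd h1 (hφ A (by simp)).1
    (fun s hs => (hφ s hs.ge).2) hb (fun s hs => by simpa [hL] using h1 s hs) L
  simpa using this

/-- The coefficients and `m ^ (-s)` are both square-summable, and a product is at most the sum of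
the squares. -/
theorem LSeriesSummable_of_half_lt_re (hA : 0 < A) (hd : DifferentiableOn ℂ φ (rightHalfPlane 0))
    (h1 : ∀ s ∈ rightHalfPlane 0, ‖φ s‖ ≤ 1)
    (hφ : ∀ s : ℂ, A ≤ s.re → LSeriesSummable a s ∧ φ s = LSeries a s)
    {s : ℂ} (hs : 1 / 2 < s.re) : LSeriesSummable a s := by
  have hsq : Summable fun m => ‖a (m + 1)‖ ^ 2 := by
    refine summable_of_sum_range_le (c := 1) (fun _ => by positivity) fun n => ?_
    refine le_trans (le_of_eq ?_) (sum_norm_sq_coeff_le_one hA hd h1 hφ n)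
    rw [Finset.range_eq_Ico, Finset.sum_Ico_add' (fun m => ‖a m‖ ^ 2) 0 n 1]
    rfl
  have hsq' : Summable fun m => ‖a m‖ ^ 2 := (summable_nat_add_iff 1).1 hsq
  have hz : Summable fun m : ℕ => 1 / (m : ℝ) ^ (2 * s.re) :=
    Real.summable_one_div_nat_rpow.2 (by linarith)
  refine Summable.of_norm_bounded (hsq'.add hz) fun m => ?_
  rw [LSeries.norm_term_eq]
  split_ifs with hm
  · positivity
  · have : 1 / (m : ℝ) ^ (2 * s.re) = (1 / (m : ℝ) ^ s.re) ^ 2 := by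
      rw [mul_comm, Real.rpow_mul (by positivity), div_pow]
      simp
    rw [this, div_eq_mul_one_div]
    nlinarith [sq_nonneg (‖a m‖ - 1 / (m : ℝ) ^ s.re), sq_nonneg (‖a m‖ + 1 / (m : ℝ) ^ s.re)]

theorem eq_LSeries_of_half_lt_re (hA : 0 < A) (hd : DifferentiableOn ℂ φ (rightHalfPlane 0))
    (h1 : ∀ s ∈ rightHalfPlane 0, ‖φ s‖ ≤ 1)
    (hφ : ∀ s : ℂ, A ≤ s.re → LSeriesSummable a s ∧ φ s = LSeries a s)
    {s : ℂ} (hs : 1 / 2 < s.re) : φ s = LSeries a s := by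
  have hopen : ∀ x : ℝ, IsOpen {s : ℂ | x < s.re} := fun x =>
    isOpen_lt continuous_const continuous_re
  have habs : LSeries.abscissaOfAbsConv a ≤ ((1 / 2 : ℝ) : EReal) :=
    LSeries.abscissaOfAbsConv_le_of_forall_lt_LSeriesSummable fun y hy =>
      LSeriesSummable_of_half_lt_re hA hd h1 hφ (by simpa using hy)
  have hL : AnalyticOnNhd ℂ (LSeries a) {s : ℂ | 1 / 2 < s.re} :=
    (LSeries_analyticOnNhd a).mono fun z hz =>
      lt_of_le_of_lt habs (by exact_mod_cast hz)
  have hφa : AnalyticOnNhd ℂ φ {s : ℂ | 1 / 2 < s.re} :=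
    (hd.mono fun z (hz : 1 / 2 < z.re) => lt_trans (by norm_num) hz).analyticOnNhd (hopen _)
  refine hφa.eqOn_of_preconnected_of_eventuallyEq hL
    (convex_halfSpace_re_gt (1 / 2)).isPreconnected (z₀ := ((A + 1 : ℝ) : ℂ)) ?_ ?_ hs
  · simp only [Set.mem_ofPred_eq, ofReal_re]; linarith
  · filter_upwards [(hopen A).mem_nhds (by simp : ((A + 1 : ℝ) : ℂ) ∈ {s : ℂ | A < s.re})]
      with z hz using (hφ z (le_of_lt hz)).2

end Multiplier

/-! ### The zeta kernel and its Pick matrix -/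

lemma hasSum_conj_term_mul_term {s t : ℂ} (hs : 1 / 2 < s.re) (ht : 1 / 2 < t.re) :
    HasSum (fun m => conj (LSeries.term 1 s m) * LSeries.term 1 t m) (riemannZeta (conj s + t)) := by
  have h := LSeriesHasSum_one (s := conj s + t) (by simp only [add_re, conj_re]; linarith)
  refine h.congr_fun fun m => ?_
  rcases eq_or_ne m 0 with rfl | hm
  · simp
  have hmC : (m : ℂ) ≠ 0 := by exact_mod_cast hm
  have hconj : conj ((m : ℂ) ^ s) = (m : ℂ) ^ conj s := by
    rw [cpow_conj _ _ (by rw [natCast_arg]; exact Real.pi_pos.ne), conj_natCast]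
  simp only [LSeries.term_of_ne_zero hm, map_div₀, hconj, cpow_add _ _ hmC, Pi.one_apply, map_one]
  field_simp

section Kernel

variable {ι : Type*} [Fintype ι] {lam : ι → ℂ}

lemma hasSum_norm_sq_sum_term (hlam : ∀ j, 1 / 2 < (lam j).re) (x : ι → ℂ) :
    HasSum (fun m => ((‖∑ j, x j * LSeries.term 1 (lam j) m‖ ^ 2 : ℝ) : ℂ))
      (∑ i, ∑ j, conj (x i) * x j * riemannZeta (conj (lam i) + lam j)) := by
  have h := hasSum_sum (s := Finset.univ) fun i _ => hasSum_sum (s := Finset.univ) fun j _ =>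
    (hasSum_conj_term_mul_term (hlam i) (hlam j)).mul_left (conj (x i) * x j)
  refine h.congr_fun fun m => ?_
  rw [ofReal_pow, ← conj_mul', map_sum, Finset.sum_mul_sum]
  refine Finset.sum_congr rfl fun i _ => Finset.sum_congr rfl fun j _ => ?_
  rw [map_mul]
  ring

/-- The adjoint of multiplication by `φ` scales each kernel vector by a value of `φ`, and it is
contractive with the multiplier. The duality is run by hand on finite truncations. -/
theorem tsum_norm_sq_sum_term_le {φ : ℂ → ℂ} {a : ℕ → ℂ} {A : ℝ} (hA : 0 < A)
    (hd : DifferentiableOn ℂ φ (rightHalfPlane 0)) (h1 : ∀ s ∈ rightHalfPlane 0, ‖φ s‖ ≤ 1)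
    (hφ : ∀ s : ℂ, A ≤ s.re → LSeriesSummable a s ∧ φ s = LSeries a s)
    (hlam : ∀ j, 1 / 2 < (lam j).re) (x : ι → ℂ) :
    ∑' m, ‖∑ j, x j * φ (lam j) * LSeries.term 1 (lam j) m‖ ^ 2 ≤
      ∑' m, ‖∑ j, x j * LSeries.term 1 (lam j) m‖ ^ 2 := by
  set g : ℕ → ℂ := fun m => ∑ j, x j * LSeries.term 1 (lam j) m with hg
  set h : ℕ → ℂ := fun m => ∑ j, x j * φ (lam j) * LSeries.term 1 (lam j) m with hh
  have hgs : Summable fun m => ‖g m‖ ^ 2 := by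
    have := (hasSum_norm_sq_sum_term hlam x).summable
    exact_mod_cast this
  set G := ∑' m, ‖g m‖ ^ 2
  have hfin : ∀ M, ∑ m ∈ Finset.Icc 1 M, ‖h m‖ ^ 2 ≤ G := by
    intro M
    set E := ∑ m ∈ Finset.Icc 1 M, ‖h m‖ ^ 2 with hE
    -- The extremal test polynomial: pairing it with `h` gives `E`, its own squared norm.
    set b : ℕ → ℂ := fun m => if m ∈ Finset.Icc 1 M then conj (h m) else 0 with hb
    have hbM : ∀ m ∉ Finset.Icc 1 M, b m = 0 := fun m hm => if_neg hm
    have hbE : ∑ m ∈ Finset.Icc 1 M, ‖b m‖ ^ 2 = E :=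
      Finset.sum_congr rfl fun m hm => by simp only [hb, if_pos hm, RCLike.norm_conj]
    have hterm : ∀ (c : ℕ → ℂ) (s : ℂ) (m : ℕ), LSeries.term c s m = c m * LSeries.term 1 s m := by
      intro c s m
      rcases eq_or_ne m 0 with rfl | hm
      · simp
      · simp [LSeries.term_of_ne_zero hm, div_eq_mul_inv]
    have hEval : (E : ℂ) = ∑ j, x j * LSeries (LSeries.convolution a b) (lam j) := by
      have : ∀ j, LSeries (LSeries.convolution a b) (lam j) =
          φ (lam j) * LSeries b (lam j) := fun j => by
        rw [LSeries_convolution' (LSeriesSummable_of_half_lt_re hA hd h1 hφ (hlam j))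
          (LSeriesSummable_of_support hbM _), eq_LSeries_of_half_lt_re hA hd h1 hφ (hlam j)]
      simp only [this, LSeries_eq_sum_of_support hbM, Finset.mul_sum]
      rw [Finset.sum_comm, hE, ofReal_sum]
      refine Finset.sum_congr rfl fun m hm => ?_
      rw [ofReal_pow, ← conj_mul']
      have hbm : b m = conj (h m) := if_pos hm
      simp only [fun j => hterm b (lam j) m, hbm]
      conv_lhs => rw [show h m = ∑ j, x j * φ (lam j) * LSeries.term 1 (lam j) m from rfl,
        Finset.mul_sum]
      exact Finset.sum_congr rfl fun j _ => by ring
    have hsum : HasSum (fun l => LSeries.convolution a b l * g l) E := by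
      rw [hEval]
      have := hasSum_sum (s := Finset.univ) fun j _ =>
        ((LSeriesSummable_of_half_lt_re hA hd h1 hφ (hlam j)).convolution
          (LSeriesSummable_of_support hbM _)).hasSum.mul_left (x j)
      refine this.congr_fun fun l => ?_
      rw [hg, Finset.mul_sum]
      exact Finset.sum_congr rfl fun j _ => by rw [hterm (LSeries.convolution a b)]; ring
    have hpart : ∀ L, ‖∑ l ∈ Finset.Icc 1 L, LSeries.convolution a b l * g l‖ ^ 2 ≤ E * G := by
      intro L
      have hcs := Finset.sum_mul_sq_le_sq_mul_sq (Finset.Icc 1 L)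
        (fun l => ‖LSeries.convolution a b l‖) (fun l => ‖g l‖)
      have hn : ‖∑ l ∈ Finset.Icc 1 L, LSeries.convolution a b l * g l‖ ≤
          ∑ l ∈ Finset.Icc 1 L, ‖LSeries.convolution a b l‖ * ‖g l‖ :=
        norm_sum_le_of_le _ fun l _ => (norm_mul _ _).le
      refine (pow_le_pow_left₀ (norm_nonneg _) hn 2).trans (hcs.trans ?_)
      refine mul_le_mul ?_ (hgs.sum_le_tsum _ fun _ _ => by positivity)
        (Finset.sum_nonneg fun _ _ => by positivity) (Finset.sum_nonneg fun _ _ => by positivity)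
      exact (sum_norm_sq_convolution_le hA hd h1 hφ hbM L).trans hbE.le
    -- Cauchy–Schwarz and contractivity give `E² ≤ E * G`, so `E ≤ G`.
    have hlim := le_of_tendsto' (((hsum.tendsto_sum_Icc (by simp)).norm).pow 2) hpart
    rw [norm_real, Real.norm_eq_abs, sq_abs, sq] at hlim
    have hE0 : 0 ≤ E := Finset.sum_nonneg fun _ _ => by positivity
    rcases hE0.eq_or_lt with h0 | h0
    · rw [← h0]; exact tsum_nonneg fun _ => by positivity
    · exact le_of_mul_le_mul_left hlim h0
  refine Real.tsum_le_of_sum_range_le (fun _ => by positivity) fun n => ?_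
  refine le_trans ?_ (hfin n)
  rw [sum_Icc_one_eq_sum_range (by simp [hh])]
  exact Finset.sum_le_sum_of_subset_of_nonneg (Finset.range_subset_range.2 (by omega))
    fun _ _ _ => by positivity

/-- The Pick matrix for the kernel of the Hardy space of Dirichlet series is positive
semi-definite. -/
theorem posSemidef_pick_zeta {φ : ℂ → ℂ} {a : ℕ → ℂ} {A : ℝ} (hA : 0 < A)
    (hd : DifferentiableOn ℂ φ (rightHalfPlane 0)) (h1 : ∀ s ∈ rightHalfPlane 0, ‖φ s‖ ≤ 1)
    (hφ : ∀ s : ℂ, A ≤ s.re → LSeriesSummable a s ∧ φ s = LSeries a s)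
    (hlam : ∀ j, 1 / 2 < (lam j).re) :
    (Matrix.of fun i j =>
      (1 - conj (φ (lam i)) * φ (lam j)) * riemannZeta (conj (lam i) + lam j)).PosSemidef := by
  have hzeta : ∀ i j, conj (riemannZeta (conj (lam j) + lam i)) =
      riemannZeta (conj (lam i) + lam j) := fun i j => by
    have h := (hasSum_conj_term_mul_term (hlam j) (hlam i)).map (starRingEnd ℂ) continuous_conj
    refine h.unique ((hasSum_conj_term_mul_term (hlam i) (hlam j)).congr_fun fun m => ?_)
    simp [mul_comm]
  refine Matrix.PosSemidef.of_dotProduct_mulVec_nonneg ?_ fun x => ?_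
  · ext i j
    simp only [Matrix.conjTranspose_apply, Matrix.of_apply, star_def, map_mul, hzeta, map_sub,
      map_one, conj_conj]
    ring
  · have hG := hasSum_norm_sq_sum_term hlam x
    have hH := hasSum_norm_sq_sum_term hlam fun j => x j * φ (lam j)
    have hGr := hG.tsum_eq
    have hHr := hH.tsum_eq
    rw [← ofReal_tsum] at hGr hHr
    have hle := tsum_norm_sq_sum_term_le hA hd h1 hφ hlam x
    have hval : star x ⬝ᵥ ((Matrix.of fun i j => (1 - conj (φ (lam i)) * φ (lam j)) *
        riemannZeta (conj (lam i) + lam j)).mulVec x) =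
        ((∑' m, ‖∑ j, x j * LSeries.term 1 (lam j) m‖ ^ 2 -
          ∑' m, ‖∑ j, x j * φ (lam j) * LSeries.term 1 (lam j) m‖ ^ 2 : ℝ) : ℂ) := by
      rw [ofReal_sub, hGr, hHr, ← Finset.sum_sub_distrib]
      simp only [dotProduct, Matrix.mulVec, Matrix.of_apply, Pi.star_apply, star_def,
        Finset.mul_sum, ← Finset.sum_sub_distrib, map_mul]
      exact Finset.sum_congr rfl fun i _ => Finset.sum_congr rfl fun j _ => by ring
    rw [hval]
    exact_mod_cast sub_nonneg.2 hle

end Kernel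

/-! ### Schur functions on the right half-plane -/

lemma isOpen_rightHalfPlane (δ : ℝ) : IsOpen (rightHalfPlane δ) :=
  isOpen_lt continuous_const continuous_re

lemma isPreconnected_rightHalfPlane (δ : ℝ) : IsPreconnected (rightHalfPlane δ) :=
  (convex_halfSpace_re_gt δ).isPreconnected

/-- Holomorphic functions on the right half-plane bounded by one whose modulus stays away from one
along the real axis at infinity. -/
structure IsStrictSchur (φ : ℂ → ℂ) : Prop where
  differentiableOn : DifferentiableOn ℂ φ (rightHalfPlane 0)
  norm_le_one : ∀ s ∈ rightHalfPlane 0, ‖φ s‖ ≤ 1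
  eventually_le : ∃ r < (1 : ℝ), ∀ᶠ σ : ℝ in atTop, ‖φ σ‖ ≤ r

/-- By the maximum principle, a value of modulus one would make `φ` constant, against the bound at
infinity. -/
lemma IsStrictSchur.norm_lt_one {φ : ℂ → ℂ} (h : IsStrictSchur φ) {s : ℂ}
    (hs : s ∈ rightHalfPlane 0) : ‖φ s‖ < 1 := by
  by_contra hcon
  have hs1 : ‖φ s‖ = 1 := le_antisymm (h.norm_le_one s hs) (not_lt.1 hcon)
  have hmax : IsMaxOn (norm ∘ φ) (rightHalfPlane 0) s := fun z hz => by
    simpa [hs1] using h.norm_le_one z hz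
  have heq := Complex.eqOn_of_isPreconnected_of_isMaxOn_norm (isPreconnected_rightHalfPlane 0)
    (isOpen_rightHalfPlane 0) h.differentiableOn hs hmax
  obtain ⟨r, hr, hev⟩ := h.eventually_le
  obtain ⟨σ, hσ, hσ0⟩ := (hev.and (eventually_gt_atTop 0)).exists
  have : φ σ = φ s := heq (by simpa [rightHalfPlane] using hσ0)
  rw [this, hs1] at hσ
  linarith

lemma one_sub_conj_mul_ne_zero {w z : ℂ} (hw : ‖w‖ < 1) (hz : ‖z‖ ≤ 1) : 1 - conj w * z ≠ 0 := by
  intro h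
  have h1 : conj w * z = 1 := (sub_eq_zero.1 h).symm
  have h2 : ‖conj w * z‖ = 1 := by rw [h1, norm_one]
  rw [norm_mul, RCLike.norm_conj] at h2
  nlinarith [norm_nonneg w, norm_nonneg z]

lemma normSq_one_sub_conj_mul_sub (w z : ℂ) :
    normSq (1 - conj w * z) - normSq (z - w) = (1 - normSq w) * (1 - normSq z) := by
  simp [normSq_apply]
  ring

/-- One minus the squared modulus is `(1 - ‖w‖²)(1 - ‖z‖²) / ‖1 - conj w * z‖²`, and the denominator
is at most `4`. -/
lemma norm_moebius_le {w z : ℂ} {r : ℝ} (hw : ‖w‖ < 1) (hr0 : 0 ≤ r) (hr : r ≤ 1) (hz : ‖z‖ ≤ r) :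
    ‖(z - w) / (1 - conj w * z)‖ ≤ √(1 - (1 - ‖w‖ ^ 2) * (1 - r ^ 2) / 4) := by
  have hne := one_sub_conj_mul_ne_zero hw (hz.trans hr)
  apply Real.le_sqrt_of_sq_le
  rw [norm_div, div_pow, div_le_iff₀ (by positivity)]
  have hid := normSq_one_sub_conj_mul_sub w z
  simp only [normSq_eq_norm_sq] at hid
  have h4 : ‖1 - conj w * z‖ ^ 2 ≤ 4 := by
    have : ‖1 - conj w * z‖ ≤ 2 := by
      refine (norm_sub_le _ _).trans ?_
      rw [norm_one, norm_mul, RCLike.norm_conj]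
      nlinarith [norm_nonneg w, norm_nonneg z]
    nlinarith [norm_nonneg (1 - conj w * z)]
  have hw2 : 0 ≤ 1 - ‖w‖ ^ 2 := by nlinarith [norm_nonneg w]
  have hr2 : 0 ≤ 1 - r ^ 2 := by nlinarith
  have hz2 : 1 - r ^ 2 ≤ 1 - ‖z‖ ^ 2 := by nlinarith [norm_nonneg z]
  have h5 := mul_le_mul_of_nonneg_left hz2 hw2
  have h6 := mul_le_mul_of_nonneg_left h4 (mul_nonneg hw2 hr2)
  nlinarith

lemma add_conj_ne_zero {s a : ℂ} (hs : s ∈ rightHalfPlane 0) (ha : a ∈ rightHalfPlane 0) :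
    s + conj a ≠ 0 := by
  intro h
  have := congrArg re h
  simp only [rightHalfPlane, Set.mem_ofPred_eq, add_re, conj_re, zero_re] at *
  linarith

lemma norm_sub_div_add_conj_lt_one {s a : ℂ} (hs : s ∈ rightHalfPlane 0)
    (ha : a ∈ rightHalfPlane 0) : ‖(s - a) / (s + conj a)‖ < 1 := by
  have hne := add_conj_ne_zero hs ha
  rw [norm_div, div_lt_one (norm_pos_iff.2 hne)]
  refine lt_of_pow_lt_pow_left₀ 2 (norm_nonneg _) ?_
  rw [← normSq_eq_norm_sq, ← normSq_eq_norm_sq]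
  simp only [rightHalfPlane, Set.mem_ofPred_eq] at hs ha
  simp [normSq_apply]
  nlinarith [mul_pos hs ha]

/-- This map inverts `s ↦ (s - a) / (s + conj a)` and carries the Schwarz lemma from the disc to the
half-plane. -/
lemma cayley_mem_rightHalfPlane {a z : ℂ} (ha : a ∈ rightHalfPlane 0) (hz : ‖z‖ < 1) :
    (a + conj a * z) / (1 - z) ∈ rightHalfPlane 0 := by
  have hne : 1 - z ≠ 0 := fun h => by
    rw [← sub_eq_zero.1 h, norm_one] at hz
    exact lt_irrefl _ hz
  have hpos := normSq_pos.2 hne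
  simp only [rightHalfPlane, Set.mem_ofPred_eq] at ha ⊢
  rw [div_re, ← add_div]
  refine div_pos ?_ hpos
  have hz2 : z.re * z.re + z.im * z.im < 1 := by
    rw [← normSq_apply, normSq_eq_norm_sq]
    nlinarith [norm_nonneg z]
  simp
  nlinarith [mul_pos ha (sub_pos.2 hz2)]

lemma tendsto_sub_div_add_conj (a : ℂ) :
    Tendsto (fun σ : ℝ => ((σ : ℂ) - a) / (σ + conj a)) atTop (𝓝 1) := by
  have hinv : Tendsto (fun σ : ℝ => ((σ : ℂ))⁻¹) atTop (𝓝 0) := by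
    have := (continuous_ofReal.tendsto 0).comp tendsto_inv_atTop_zero
    simpa [Function.comp_def] using this
  have h : Tendsto (fun σ : ℝ => (1 - a * (σ : ℂ)⁻¹) / (1 + conj a * (σ : ℂ)⁻¹)) atTop
      (𝓝 ((1 - a * 0) / (1 + conj a * 0))) :=
    (tendsto_const_nhds.sub (hinv.const_mul a)).div (tendsto_const_nhds.add (hinv.const_mul _))
      (by simp)
  simp only [mul_zero, sub_zero, add_zero, div_one] at h
  refine h.congr' ?_
  filter_upwards [eventually_gt_atTop 0] with σ hσ
  have hσ' : (σ : ℂ) ≠ 0 := by exact_mod_cast hσ.ne'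
  rw [← mul_div_mul_left _ _ hσ']
  congr 1 <;> field_simp

/-- One step of the Schur algorithm on the right half-plane. -/
theorem IsStrictSchur.exists_schur_step {φ : ℂ → ℂ} (h : IsStrictSchur φ) {a : ℂ}
    (ha : a ∈ rightHalfPlane 0) :
    ∃ u : ℂ → ℂ, IsStrictSchur u ∧ ∀ s ∈ rightHalfPlane 0,
      φ s - φ a = (1 - conj (φ a) * φ s) * ((s - a) / (s + conj a) * u s) := by
  have hw := h.norm_lt_one ha
  set w := φ a
  have hD : ∀ s ∈ rightHalfPlane 0, 1 - conj w * φ s ≠ 0 := fun s hs =>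
    one_sub_conj_mul_ne_zero hw (h.norm_le_one s hs)
  set V : ℂ → ℂ := fun s => (φ s - w) / (1 - conj w * φ s) with hV
  have hVd : DifferentiableOn ℂ V (rightHalfPlane 0) :=
    (h.differentiableOn.sub_const w).div ((h.differentiableOn.const_mul _).const_sub 1) hD
  set g : ℂ → ℂ := fun z => V ((a + conj a * z) / (1 - z)) with hg
  have hg0 : g 0 = 0 := by simp [hg, hV, w]
  have hball : ∀ z ∈ Metric.ball (0 : ℂ) 1, (a + conj a * z) / (1 - z) ∈ rightHalfPlane 0 :=
    fun z hz => cayley_mem_rightHalfPlane ha (by simpa using hz)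
  have hgd : DifferentiableOn ℂ g (Metric.ball 0 1) := by
    refine hVd.comp (DifferentiableOn.div (by fun_prop) (by fun_prop) fun z hz hz0 => ?_) hball
    rw [← sub_eq_zero.1 hz0] at hz
    simp at hz
  have hmaps : Set.MapsTo g (Metric.ball 0 1) (Metric.closedBall (g 0) 1) := fun z hz => by
    rw [hg0, mem_closedBall_zero_iff]
    have := norm_moebius_le hw zero_le_one le_rfl (h.norm_le_one _ (hball z hz))
    simpa [hg, hV] using this
  have hbmem : ∀ s ∈ rightHalfPlane 0, (s - a) / (s + conj a) ∈ Metric.ball (0 : ℂ) 1 :=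
    fun s hs => by simpa using norm_sub_div_add_conj_lt_one hs ha
  -- In the disc coordinate, `dslope` divides out the zero of `V` at `a`; the Schwarz lemma then
  -- bounds the quotient by one.
  have hfac : ∀ s ∈ rightHalfPlane 0,
      V s = (s - a) / (s + conj a) * dslope g 0 ((s - a) / (s + conj a)) := fun s hs => by
    have h1 := sub_smul_dslope g 0 ((s - a) / (s + conj a))
    rw [hg0, sub_zero, sub_zero, smul_eq_mul] at h1
    rw [h1, hg]
    have h2 := add_conj_ne_zero hs ha
    have h3 := add_conj_ne_zero ha ha
    have h4 : s + conj a - (s - a) ≠ 0 := by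
      rwa [show s + conj a - (s - a) = a + conj a by ring]
    have h5 : 1 - (s - a) / (s + conj a) ≠ 0 := by
      rw [one_sub_div h2]; exact div_ne_zero h4 h2
    congr 1
    rw [eq_div_iff h5]
    field_simp
    ring
  refine ⟨fun s => dslope g 0 ((s - a) / (s + conj a)), ⟨?_, fun s hs => ?_, ?_⟩, fun s hs => ?_⟩
  · exact ((Complex.differentiableOn_dslope (Metric.ball_mem_nhds 0 one_pos)).2 hgd).comp
      (DifferentiableOn.div (by fun_prop) (by fun_prop) fun s hs => add_conj_ne_zero hs ha) hbmem
  · simpa using norm_dslope_le_div_of_mapsTo_ball hgd hmaps (hbmem s hs)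
  · obtain ⟨r, hr, hev⟩ := h.eventually_le
    set r' := max r 0
    have hr' : r' < 1 := max_lt hr one_pos
    have hr0 : 0 ≤ r' := le_max_right _ _
    set ρ := √(1 - (1 - ‖w‖ ^ 2) * (1 - r' ^ 2) / 4)
    have hρ : ρ < 1 := by
      rw [Real.sqrt_lt' one_pos]
      have h1 : 0 < 1 - ‖w‖ ^ 2 := by nlinarith [norm_nonneg w]
      have h2 : 0 < 1 - r' ^ 2 := by nlinarith
      nlinarith [mul_pos h1 h2]
    have hlim : Tendsto (fun σ : ℝ => ρ / ‖((σ : ℂ) - a) / (σ + conj a)‖) atTop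
        (𝓝 (ρ / ‖(1 : ℂ)‖)) :=
      tendsto_const_nhds.div (tendsto_sub_div_add_conj a).norm (by simp)
    rw [norm_one, div_one] at hlim
    -- `‖V σ‖ ≤ ρ` eventually, and dividing by a Blaschke factor tending to `1` costs less than the
    -- gap from `ρ` to this midpoint.
    refine ⟨(1 + ρ) / 2, by linarith, ?_⟩
    filter_upwards [hev, eventually_gt_atTop 0,
      hlim.eventually_lt_const (show ρ < (1 + ρ) / 2 by linarith),
      (tendsto_sub_div_add_conj a).eventually_ne one_ne_zero] with σ h1 h2 h3 h4
    have hσ : (σ : ℂ) ∈ rightHalfPlane 0 := by simpa [rightHalfPlane] using h2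
    refine le_trans ?_ h3.le
    rw [le_div_iff₀ (norm_pos_iff.2 h4), mul_comm, ← norm_mul, ← hfac _ hσ]
    exact norm_moebius_le hw hr0 hr'.le (h1.trans (le_max_left _ _))
  · rw [← hfac s hs, hV, mul_div_cancel₀ _ (hD s hs)]

/-! ### Positive definiteness by the Schur algorithm -/

/-- Up to a scalar, the Pick kernel of `φ` is a rank-one kernel plus a rescaled Pick kernel of `u`.
With `β s = (s - a) / (s + conj a)`, the rank-one part comes from `1 - conj (β s) * β t = (a + conj
a)(conj s + t) / ((conj s + a)(t + conj a))`. -/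
lemma pick_kernel_schur_step {φ u : ℂ → ℂ} {a s t : ℂ} (ha : a ∈ rightHalfPlane 0)
    (hs : s ∈ rightHalfPlane 0) (ht : t ∈ rightHalfPlane 0)
    (hus : φ s - φ a = (1 - conj (φ a) * φ s) * ((s - a) / (s + conj a) * u s))
    (hut : φ t - φ a = (1 - conj (φ a) * φ t) * ((t - a) / (t + conj a) * u t)) :
    (1 - conj (φ a) * φ a) * ((1 - conj (φ s) * φ t) / (conj s + t)) =
      (a + conj a) * (conj ((1 - conj (φ a) * φ s) / (s + conj a)) *
        ((1 - conj (φ a) * φ t) / (t + conj a))) +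
      conj ((1 - conj (φ a) * φ s) * ((s - a) / (s + conj a))) *
        ((1 - conj (φ a) * φ t) * ((t - a) / (t + conj a))) *
        ((1 - conj (u s) * u t) / (conj s + t)) := by
  have h1 := add_conj_ne_zero hs ha
  have h2 := add_conj_ne_zero ht ha
  have h3 : conj s + t ≠ 0 := by rw [add_comm]; exact add_conj_ne_zero ht hs
  have h4 : conj s + a ≠ 0 := by rw [add_comm]; exact add_conj_ne_zero ha hs
  have hus' := congrArg (starRingEnd ℂ) hus
  have key : (1 - conj (φ a) * φ a) * (1 - conj (φ s) * φ t) =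
      conj (1 - conj (φ a) * φ s) * (1 - conj (φ a) * φ t) -
        conj (φ s - φ a) * (φ t - φ a) := by
    simp only [map_sub, map_mul, map_one, conj_conj]
    ring
  rw [← mul_div_assoc, key, hus, hut]
  simp only [map_sub, map_mul, map_one, conj_conj, map_div₀, map_add]
  field_simp
  ring

/-- The Pick form of a strict Schur function is positive definite on finite sets of points. -/
theorem IsStrictSchur.pick_form_pos (S : Finset ℂ) (hS : ∀ s ∈ S, s ∈ rightHalfPlane 0)
    {φ : ℂ → ℂ} (h : IsStrictSchur φ) {x : ℂ → ℂ} (hx : ∃ s ∈ S, x s ≠ 0) :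
    0 < ∑ s ∈ S, ∑ t ∈ S, conj (x s) * x t * ((1 - conj (φ s) * φ t) / (conj s + t)) := by
  induction S using Finset.induction_on generalizing φ x with
  | empty => simp at hx
  | insert a S haS ih =>
    have ha : a ∈ rightHalfPlane 0 := hS a (Finset.mem_insert_self _ _)
    have hS' : ∀ s ∈ S, s ∈ rightHalfPlane 0 := fun s hs => hS s (Finset.mem_insert_of_mem hs)
    have hw := h.norm_lt_one ha
    obtain ⟨u, hu, hfac⟩ := h.exists_schur_step ha
    set D : ℂ → ℂ := fun s => 1 - conj (φ a) * φ s with hD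
    have hD0 : ∀ s ∈ rightHalfPlane 0, D s ≠ 0 := fun s hs =>
      one_sub_conj_mul_ne_zero hw (h.norm_le_one s hs)
    -- The new coefficients vanish at `a` and, among points of `S`, only where `x` does; the form
    -- for `u` thus lives on `S` alone.
    set y : ℂ → ℂ := fun s => x s * (D s * ((s - a) / (s + conj a))) with hy
    have hya : y a = 0 := by simp [hy]
    set p : ℂ := ∑ t ∈ insert a S, x t * (D t / (t + conj a)) with hp
    have hwpos : 0 < 1 - ‖φ a‖ ^ 2 := by nlinarith [norm_nonneg (φ a)]
    have hdecomp : ((1 - ‖φ a‖ ^ 2 : ℝ) : ℂ) * ∑ s ∈ insert a S, ∑ t ∈ insert a S,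
        conj (x s) * x t * ((1 - conj (φ s) * φ t) / (conj s + t)) =
        ((2 * a.re * ‖p‖ ^ 2 : ℝ) : ℂ) +
          ∑ s ∈ S, ∑ t ∈ S, conj (y s) * y t * ((1 - conj (u s) * u t) / (conj s + t)) := by
      have hinsert : ∑ s ∈ S, ∑ t ∈ S, conj (y s) * y t * ((1 - conj (u s) * u t) / (conj s + t)) =
          ∑ s ∈ insert a S, ∑ t ∈ insert a S,
            conj (y s) * y t * ((1 - conj (u s) * u t) / (conj s + t)) := by
        simp [Finset.sum_insert haS, hya]
      have hp2 : ((2 * a.re * ‖p‖ ^ 2 : ℝ) : ℂ) = ∑ s ∈ insert a S, ∑ t ∈ insert a S,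
          (a + conj a) * (conj (x s * (D s / (s + conj a))) * (x t * (D t / (t + conj a)))) := by
        simp only [← Finset.mul_sum]
        rw [← Finset.sum_mul, ← map_sum, ← hp, conj_mul', add_conj]
        push_cast
        ring
      rw [hinsert, hp2, Finset.mul_sum, ← Finset.sum_add_distrib]
      refine Finset.sum_congr rfl fun s hs => ?_
      rw [Finset.mul_sum, ← Finset.sum_add_distrib]
      refine Finset.sum_congr rfl fun t ht => ?_
      have hk := pick_kernel_schur_step ha (hS s hs) (hS t ht) (hfac s (hS s hs))
        (hfac t (hS t ht))
      rw [conj_mul'] at hk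
      push_cast
      simp only [hy, map_mul] at hk ⊢
      linear_combination (conj (x s) * x t) * hk
    have hare : 0 < a.re := ha
    have hfirst : (0 : ℂ) ≤ ((2 * a.re * ‖p‖ ^ 2 : ℝ) : ℂ) := by
      rw [zero_le_real]; positivity
    have hpos : 0 < ((1 - ‖φ a‖ ^ 2 : ℝ) : ℂ) * ∑ s ∈ insert a S, ∑ t ∈ insert a S,
        conj (x s) * x t * ((1 - conj (φ s) * φ t) / (conj s + t)) := by
      rw [hdecomp]
      by_cases hxS : ∃ s ∈ S, x s ≠ 0
      · obtain ⟨s, hs, hxs⟩ := hxS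
        refine add_pos_of_nonneg_of_pos hfirst (ih hS' hu ⟨s, hs, ?_⟩)
        have hsa : s - a ≠ 0 := sub_ne_zero.2 fun hsa => haS (hsa ▸ hs)
        exact mul_ne_zero hxs (mul_ne_zero (hD0 s (hS' s hs))
          (div_ne_zero hsa (add_conj_ne_zero (hS' s hs) ha)))
      · push Not at hxS
        have hxa : x a ≠ 0 := by
          obtain ⟨s, hs, hxs⟩ := hx
          rcases Finset.mem_insert.1 hs with rfl | hs
          · exact hxs
          · exact absurd (hxS s hs) hxs
        -- With `x` supported at `a`, the form for `u` vanishes and the rank-one part supplies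
        -- positivity.
        have hzero : ∑ s ∈ S, ∑ t ∈ S,
            conj (y s) * y t * ((1 - conj (u s) * u t) / (conj s + t)) = 0 :=
          Finset.sum_eq_zero fun s hs => Finset.sum_eq_zero fun t _ => by simp [hy, hxS s hs]
        have hpa : p = x a * (D a / (a + conj a)) := by
          rw [hp, Finset.sum_insert haS, Finset.sum_eq_zero fun t ht => by rw [hxS t ht, zero_mul],
            add_zero]
        have hp0 : p ≠ 0 := by
          rw [hpa]
          exact mul_ne_zero hxa (div_ne_zero (hD0 a ha) (add_conj_ne_zero ha ha))
        rw [hzero, add_zero, zero_lt_real]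
        have := norm_pos_iff.2 hp0
        positivity
    exact (mul_pos_iff_of_pos_left (zero_lt_real.2 hwpos)).1 hpos

theorem IsStrictSchur.posDef_pick {ι : Type*} [Fintype ι] {φ : ℂ → ℂ} (h : IsStrictSchur φ)
    {lam : ι → ℂ} (hinj : Function.Injective lam) (hlam : ∀ j, lam j ∈ rightHalfPlane 0) :
    (Matrix.of fun i j =>
      (1 - conj (φ (lam i)) * φ (lam j)) / (conj (lam i) + lam j)).PosDef := by
  refine Matrix.PosDef.of_dotProduct_mulVec_pos ?_ fun x hx => ?_
  · ext i j
    simp only [Matrix.conjTranspose_apply, Matrix.of_apply, star_def, map_mul, map_div₀, map_sub,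
      map_one, conj_conj, map_add]
    rw [mul_comm, add_comm]
  · obtain ⟨j, hj⟩ := Function.ne_iff.1 hx
    have hX : ∀ i, Function.extend lam x 0 (lam i) = x i := fun i => hinj.extend_apply x 0 i
    have hpos := h.pick_form_pos (Finset.univ.map ⟨lam, hinj⟩) (by simpa using hlam)
      (x := Function.extend lam x 0) ⟨lam j, by simp, by rw [hX]; exact hj⟩
    simp only [Finset.sum_map, Function.Embedding.coeFn_mk, hX] at hpos
    convert hpos using 1
    simp only [dotProduct, Matrix.mulVec, Matrix.of_apply, Pi.star_apply, star_def, Finset.mul_sum]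
    exact Finset.sum_congr rfl fun i _ => Finset.sum_congr rfl fun j _ => by ring

/-! ### Strictness at infinity and conclusion -/

/-- If `‖a 1‖ ≥ 1`, the bound `∑ ‖a l‖² ≤ 1` kills every other coefficient, so `φ s = a 1`, against
`‖φ s‖ < 1`. -/
lemma norm_coeff_one_lt_one {φ : ℂ → ℂ} {a : ℕ → ℂ} {A : ℝ} (hA : 0 < A)
    (hd : DifferentiableOn ℂ φ (rightHalfPlane 0)) (h1 : ∀ s ∈ rightHalfPlane 0, ‖φ s‖ ≤ 1)
    (hφ : ∀ s : ℂ, A ≤ s.re → LSeriesSummable a s ∧ φ s = LSeries a s)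
    {s : ℂ} (hs : 1 / 2 < s.re) (hlt : ‖φ s‖ < 1) : ‖a 1‖ < 1 := by
  by_contra! hcon
  have hzero : ∀ l ∉ Finset.Icc 1 1, LSeries.term a s l = 0 := by
    intro l hl
    rcases eq_or_ne l 0 with rfl | hl0
    · simp
    have hl1 : l ≠ 1 := by simpa using hl
    have hsum := sum_norm_sq_coeff_le_one hA hd h1 hφ l
    have hsub : ({1, l} : Finset ℕ) ⊆ Finset.Icc 1 l := by
      intro m hm
      simp only [Finset.mem_insert, Finset.mem_singleton] at hm
      rw [Finset.mem_Icc]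
      omega
    have := (Finset.sum_le_sum_of_subset_of_nonneg hsub fun _ _ _ => by positivity).trans hsum
    rw [Finset.sum_pair hl1.symm] at this
    have hal : a l = 0 := by
      rw [← norm_eq_zero, ← sq_eq_zero_iff]
      nlinarith [sq_nonneg ‖a l‖]
    simp [LSeries.term_def, hal]
  have : φ s = a 1 := by
    rw [eq_LSeries_of_half_lt_re hA hd h1 hφ hs, LSeries, tsum_eq_sum hzero]
    simp
  rw [this] at hlt
  linarith

lemma isStrictSchur_of_LSeries {φ : ℂ → ℂ} {a : ℕ → ℂ} {A : ℝ} (hA : 0 < A)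
    (hd : DifferentiableOn ℂ φ (rightHalfPlane 0)) (h1 : ∀ s ∈ rightHalfPlane 0, ‖φ s‖ ≤ 1)
    (hφ : ∀ s : ℂ, A ≤ s.re → LSeriesSummable a s ∧ φ s = LSeries a s)
    {s : ℂ} (hs : 1 / 2 < s.re) (hlt : ‖φ s‖ < 1) : IsStrictSchur φ := by
  refine ⟨hd, h1, (1 + ‖a 1‖) / 2, ?_, ?_⟩ <;>
    have ha1 := norm_coeff_one_lt_one hA hd h1 hφ hs hlt
  · linarith
  · have habs : LSeries.abscissaOfAbsConv a < ⊤ :=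
      lt_of_le_of_lt (hφ A (by simp)).1.abscissaOfAbsConv_le (by simp)
    have hlim := (LSeries.tendsto_atTop habs).norm
    filter_upwards [hlim.eventually_lt_const (show ‖a 1‖ < (1 + ‖a 1‖) / 2 by linarith),
      eventually_ge_atTop A] with σ h2 h3
    rw [(hφ σ (by simpa using h3)).2]
    exact h2.le

theorem theorem2p1 (n : ℕ) (lam w : Fin n → ℂ)
    (hlam_inj : Function.Injective lam)
    (hlam : ∀ j, lam j ∈ rightHalfPlane (1 / 2))
    (hw : ∀ j, w j ∈ Metric.ball (0 : ℂ) 1)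
    (hφ : ∃ φ : ℂ → ℂ, φ ∈ HInfty (rightHalfPlane 0) ∩ dirichletRepresentable ∧
      hInftyNorm (rightHalfPlane 0) φ ≤ 1 ∧ ∀ j, φ (lam j) = w j) :
    (Matrix.of fun i j : Fin n =>
      (1 - conj (w i) * w j) * riemannZeta (conj (lam i) + lam j)).PosSemidef ∧
    (Matrix.of fun i j : Fin n =>
      (1 - conj (w i) * w j) / (conj (lam i) + lam j)).PosSemidef ∧
    (Matrix.of fun i j : Fin n =>
      (1 - conj (w i) * w j) / (conj (lam i) + lam j)).rank = n := by
  obtain ⟨φ, ⟨⟨hd, M, hM⟩, hrep⟩, hnorm, hval⟩ := hφ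
  have h1 : ∀ s ∈ rightHalfPlane 0, ‖φ s‖ ≤ 1 := fun s hs =>
    (le_ciSup (f := fun s : rightHalfPlane 0 => ‖φ s‖)
      ⟨M, by rintro _ ⟨s, rfl⟩; exact hM s s.2⟩ ⟨s, hs⟩).trans hnorm
  obtain ⟨a, A, hA, hφ⟩ := exists_LSeries_of_dirichletRepresentable hrep
  have hPD : (Matrix.of fun i j : Fin n =>
      (1 - conj (w i) * w j) / (conj (lam i) + lam j)).PosDef := by
    -- Strictness is drawn from some `‖w j‖ < 1`; without nodes `φ` may be a unimodular constant,
    -- but the claim is vacuous.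
    rcases isEmpty_or_nonempty (Fin n) with hn | ⟨⟨j⟩⟩
    · exact Matrix.PosDef.of_dotProduct_mulVec_pos (Subsingleton.elim _ _)
        fun x hx => absurd (Subsingleton.elim x 0) hx
    · have hS := isStrictSchur_of_LSeries hA hd h1 hφ (hlam j) (by simpa [hval] using hw j)
      simpa only [hval] using hS.posDef_pick hlam_inj fun i =>
        lt_trans (by norm_num : (0 : ℝ) < 1 / 2) (hlam i)
  refine ⟨?_, hPD.posSemidef, ?_⟩
  · simpa only [hval] using posSemidef_pick_zeta hA hd h1 hφ hlam
  · simpa using Matrix.rank_of_isUnit _ hPD.isUnit
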